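/- Let $f:\mathbb{R}^n\to\mathbb{R}^n$ be a polynomial vector field and let $X=\{x\in\mathbb{R}^n : g_i(x)\ge 0,\ i=1,\dots,m\}$, with $g_1,\dots,g_m$ real polynomials, be nonempty and compact. Put $\partial X := X\setminus \operatorname{int}(X)$ and let $\lambda$ be the $n$-dimensional Lebesgue measure on $X$. For a Borel set $A$ let $\mathcal{M}^+(A)$ be the cone of finite nonnegative Borel measures supported on $A$, let $C^0(X)$ be the space of continuous functions on $X$, and let $C^1(X)$ be the space of $C^1$ functions $v:\mathbb{R}^n\to\mathbb{R}$ regarded on $X$ together with their gradients. For $T\ge 0$ let $$p^T := \sup\ \mu_0(X)$$ over all $\mu_0,\hat\mu_0,\mu\in\mathcal{M}^+(X)$ and $\mu_\partial\in\mathcal{M}^+(\partial X)$ such that $$\operatorname{div}(f\mu)+\mu_\partial=\mu_0,\qquad \mu_0+\hat\mu_0=\lambda,\qquad \mu(X)\le T\,\lambda(X),$$ where the first equation means $-\int \nabla v\cdot f\,d\mu+\int v\,d\mu_\partial=\int v\,d\mu_0$ for all $v\in C^1(X)$. Let $$d^T := \inf\ \int_X (w(x)+uT)\,d\lambda(x)$$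 over all real $u\ge 0$, $v\in C^1(X)$ and $w\in C^0(X)$ such that $\nabla v\cdot f\le u$, $w\ge v+1$ and $w\ge 0$ on $X$, and $v\ge 0$ on $\partial X$. Then for every $T\ge 0$ there is no duality gap between these two linear programs: $p^T=d^T$. -/

import Mathlib

open MeasureTheory

noncomputable section

/-- The basic semi-algebraic set `{x ∈ ℝⁿ : g_i(x) ≥ 0 for all i}`. -/
def semialgSet {n m : ℕ} (g : Fin m → MvPolynomial (Fin n) ℝ) :
    Set (EuclideanSpace ℝ (Fin n)) :=
  {x | ∀ i, 0 ≤ MvPolynomial.eval (fun j => x j) (g i)}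

/-- The polynomial vector field on `ℝⁿ` with components `F_1, …, F_n`. -/
def polyField {n : ℕ} (F : Fin n → MvPolynomial (Fin n) ℝ) :
    EuclideanSpace ℝ (Fin n) → EuclideanSpace ℝ (Fin n) :=
  fun x => WithLp.toLp 2 (fun i => MvPolynomial.eval (fun j => x j) (F i))

/-- The boundary `∂X := X \ int X`. -/
def bdry {n : ℕ} (X : Set (EuclideanSpace ℝ (Fin n))) : Set (EuclideanSpace ℝ (Fin n)) :=
  X \ interior X

/-- `∇v · f`, the derivative of `v` along the vector field `f`. -/
def lieDer {n : ℕ} (f : EuclideanSpace ℝ (Fin n) → EuclideanSpace ℝ (Fin n))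
    (v : EuclideanSpace ℝ (Fin n) → ℝ) (x : EuclideanSpace ℝ (Fin n)) : ℝ :=
  fderiv ℝ v x (f x)

/-- The distributional divergence `⟨div(f μ), v⟩ = -∫ ∇v · f dμ`. -/
def divPairing {n : ℕ} (f : EuclideanSpace ℝ (Fin n) → EuclideanSpace ℝ (Fin n))
    (μ : Measure (EuclideanSpace ℝ (Fin n))) (v : EuclideanSpace ℝ (Fin n) → ℝ) : ℝ :=
  -∫ x, lieDer f v x ∂μ

/-- `μ` belongs to `M⁺(A)`: a finite nonnegative Borel measure carried by the set `A`. -/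
structure IsMeasureOn {n : ℕ} (A : Set (EuclideanSpace ℝ (Fin n)))
    (μ : Measure (EuclideanSpace ℝ (Fin n))) : Prop where
  finite : IsFiniteMeasure μ
  supported : μ Aᶜ = 0

/-- Feasibility of `(μ₀, μ̂₀, μ, μ_∂)` in the primal LP. The first equation is an equation of
distributions, tested on `C¹(X)`, the functions on `X` that are `C¹` on `ℝⁿ`. -/
structure PrimalFeasible {n : ℕ} (X : Set (EuclideanSpace ℝ (Fin n)))
    (f : EuclideanSpace ℝ (Fin n) → EuclideanSpace ℝ (Fin n)) (T : ℝ)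
    (μ₀ μhat₀ μ μb : Measure (EuclideanSpace ℝ (Fin n))) : Prop where
  mem_initial : IsMeasureOn X μ₀
  mem_slack : IsMeasureOn X μhat₀
  mem_occupation : IsMeasureOn X μ
  mem_boundary : IsMeasureOn (bdry X) μb
  liouville : ∀ v : EuclideanSpace ℝ (Fin n) → ℝ, ContDiff ℝ 1 v →
    divPairing f μ v + ∫ x, v x ∂μb = ∫ x, v x ∂μ₀
  domination : μ₀ + μhat₀ = volume.restrict X
  mass_le : μ X ≤ ENNReal.ofReal T * volume X

/-- The value `p^T` of the primal LP: the supremum of `μ₀(X)` over feasible quadruplets. -/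
def primalValue {n : ℕ} (X : Set (EuclideanSpace ℝ (Fin n)))
    (f : EuclideanSpace ℝ (Fin n) → EuclideanSpace ℝ (Fin n)) (T : ℝ) : EReal :=
  sSup {r : EReal | ∃ μ₀ μhat₀ μ μb : Measure (EuclideanSpace ℝ (Fin n)),
    PrimalFeasible X f T μ₀ μhat₀ μ μb ∧ r = ((μ₀ X : ENNReal) : EReal)}

/-- Feasibility of `(u, v, w)` in the dual LP, with `u ≥ 0`, `v ∈ C¹(X)`, `w ∈ C⁰(X)`. -/
structure DualFeasible {n : ℕ} (X : Set (EuclideanSpace ℝ (Fin n)))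
    (f : EuclideanSpace ℝ (Fin n) → EuclideanSpace ℝ (Fin n))
    (u : ℝ) (v w : EuclideanSpace ℝ (Fin n) → ℝ) : Prop where
  u_nonneg : 0 ≤ u
  v_contDiff : ContDiff ℝ 1 v
  w_continuousOn : ContinuousOn w X
  lieDer_le : ∀ x ∈ X, lieDer f v x ≤ u
  w_ge : ∀ x ∈ X, v x + 1 ≤ w x
  w_nonneg : ∀ x ∈ X, 0 ≤ w x
  v_nonneg : ∀ x ∈ bdry X, 0 ≤ v x

/-- The value `d^T` of the dual LP: the infimum of `∫_X (w + u T) dλ` over feasible triplets. -/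
def dualValue {n : ℕ} (X : Set (EuclideanSpace ℝ (Fin n)))
    (f : EuclideanSpace ℝ (Fin n) → EuclideanSpace ℝ (Fin n)) (T : ℝ) : EReal :=
  sInf {r : EReal | ∃ (u : ℝ) (v w : EuclideanSpace ℝ (Fin n) → ℝ),
    DualFeasible X f u v w ∧ r = ((∫ x in X, (w x + u * T) : ℝ) : EReal)}

end

/-!
Weak duality is the Liouville equation tested on the dual function `v`: since `∇v · f ≤ u`,
`v ≥ 0` on the boundary and `w ≥ max (v + 1) 0`, one gets
`∫ (w + uT) dλ ≥ ∫ (v + 1) dμ₀ + u μ(X) ≥ μ₀(X)`.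

For the converse no closedness argument is needed. Perturb the right-hand sides of the dual
constraints by `z = (a, b, c, e) ∈ C(X)³ × C(∂X)`, replacing them by `a ≤ u - ∇v · f`,
`b ≤ w - v`, `c ≤ w` on `X` and `e ≤ v` on `∂X`. The pairs of a perturbation and an attainable
cost form a convex cone (`dualCone`), so the perturbed value is sublinear in `z`. It is finite:
constants `u`, `v`, `w` satisfy any perturbed constraints, and `c ≤ w` bounds the cost below by
`∫ c dλ`. The unperturbed dual is the point `z₀ = (0, 1, 0, 0)`. By Hahn–Banach there is a linear
functional below the perturbed value that agrees with it at `z₀`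
(`exists_linearMap_le_of_cone`). Its four components are positive, so by Riesz–Markov–Kakutani
(`exists_isMeasureOn_of_nonneg`) they are integrals against measures `μ, μ₀, μ̂₀, μ_∂`. Testing
the functional on the perturbations for which a given `(u, v, w)` is tight yields exactly the
primal constraints, and its value at `z₀`, the dual optimum, is `μ₀(X)`.
-/

open MeasureTheory Set

/-! ### A Hahn–Banach principle for convex cones -/

/-- Strong duality for a conic program depending on a right-hand side `z`, in the absence of any
topology: if the convex cone `C` consists of pairs of a right-hand side and an attainable cost, and
the optimal value `sInf {r | (z, r) ∈ C}` is finite for every `z`, then this value has a linear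
minorant that is exact at a prescribed `z₀`. -/
theorem exists_linearMap_le_of_cone {E : Type*} [AddCommGroup E] [Module ℝ E]
    (C : ConvexCone ℝ (E × ℝ)) (hne : ∀ z, {r : ℝ | (z, r) ∈ C}.Nonempty)
    (hbdd : ∀ z, BddBelow {r : ℝ | (z, r) ∈ C}) {z₀ : E} (hz₀ : z₀ ≠ 0) :
    ∃ L : E →ₗ[ℝ] ℝ, (∀ z r, (z, r) ∈ C → L z ≤ r) ∧ L z₀ = sInf {r : ℝ | (z₀, r) ∈ C} := by
  set N : E → ℝ := fun z => sInf {r : ℝ | (z, r) ∈ C}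
  have N_le : ∀ {z r}, (z, r) ∈ C → N z ≤ r := fun h => csInf_le (hbdd _) h
  have N_hom_le : ∀ c : ℝ, 0 < c → ∀ z, N (c • z) ≤ c * N z := by
    intro c hc z
    rw [← div_le_iff₀' hc]
    refine le_csInf (hne z) fun r hr => ?_
    rw [div_le_iff₀' hc]
    exact N_le (C.smul_mem hc hr)
  have N_hom : ∀ c : ℝ, 0 < c → ∀ z, N (c • z) = c * N z := by
    intro c hc z
    refine le_antisymm (N_hom_le c hc z) ?_
    have h := N_hom_le c⁻¹ (inv_pos.2 hc) (c • z)
    rwa [inv_smul_smul₀ hc.ne', le_inv_mul_iff₀ hc] at h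
  have N_add : ∀ x y, N (x + y) ≤ N x + N y := by
    intro x y
    rw [← sub_le_iff_le_add]
    refine le_csInf (hne x) fun r hr => ?_
    rw [sub_le_comm]
    refine le_csInf (hne y) fun s hs => ?_
    rw [sub_le_iff_le_add']
    exact N_le (C.add_mem hr hs)
  have N_zero : N 0 = 0 := by
    have h := N_hom 2 two_pos 0
    rw [smul_zero] at h
    linarith
  obtain ⟨L, hL, hLN⟩ := exists_extension_of_le_sublinear
    (LinearPMap.mkSpanSingleton z₀ (N z₀) hz₀) N N_hom N_add (by
      rintro ⟨x, hx⟩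
      obtain ⟨t, rfl⟩ := Submodule.mem_span_singleton.1 hx
      have hval : (LinearPMap.mkSpanSingleton z₀ (N z₀) hz₀) ⟨t • z₀, hx⟩ = t * N z₀ :=
        LinearPMap.mkSpanSingleton'_apply _ _ _ _ _
      rw [hval]
      rcases lt_trichotomy t 0 with ht | rfl | ht
      · have h₁ := N_add (t • z₀) ((-t) • z₀)
        rw [← add_smul, add_neg_cancel, zero_smul, N_zero, N_hom (-t) (neg_pos.2 ht)] at h₁
        simp only
        linarith
      · simp [N_zero]
      · exact (N_hom t ht z₀).ge)
  refine ⟨L, fun z r h => (hLN z).trans (N_le h), ?_⟩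
  have h := hL ⟨z₀, Submodule.mem_span_singleton_self z₀⟩
  rw [LinearPMap.mkSpanSingleton_apply] at h
  exact h

/-! ### Positive functionals on a compact subset of Euclidean space -/

/-- The Riesz–Markov–Kakutani theorem on a compact subset `A` of `ℝⁿ`, with the representing
measure living on `ℝⁿ` and carried by `A`. -/
theorem exists_isMeasureOn_of_nonneg {n : ℕ} {A : Set (EuclideanSpace ℝ (Fin n))}
    (hA : IsCompact A) (Λ : C(A, ℝ) →ₗ[ℝ] ℝ) (hΛ : ∀ a, 0 ≤ a → 0 ≤ Λ a) :
    ∃ μ : Measure (EuclideanSpace ℝ (Fin n)), IsMeasureOn A μ ∧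
      ∀ (h : EuclideanSpace ℝ (Fin n) → ℝ) (a : C(A, ℝ)), (∀ x : A, h x = a x) →
        ∫ x, h x ∂μ = Λ a := by
  have : CompactSpace A := isCompact_iff_compactSpace.1 hA
  let Λ' : CompactlySupportedContinuousMap A ℝ →ₗ[ℝ] ℝ :=
    { toFun := fun a => Λ a.toContinuousMap
      map_add' := fun a b => Λ.map_add a.toContinuousMap b.toContinuousMap
      map_smul' := fun c a => Λ.map_smul c a.toContinuousMap }
  let P := PositiveLinearMap.mk₀ Λ' fun a (ha : ∀ x, 0 ≤ a x) => hΛ a.toContinuousMap ha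
  have hemb : MeasurableEmbedding (Subtype.val : A → EuclideanSpace ℝ (Fin n)) :=
    .subtype_coe hA.measurableSet
  refine ⟨(RealRMK.rieszMeasure P).map Subtype.val, ⟨inferInstance, ?_⟩, fun h a ha => ?_⟩
  · rw [hemb.map_apply]
    simp
  · rw [hemb.integral_map]
    simp_rw [ha]
    exact RealRMK.integral_rieszMeasure P (CompactlySupportedContinuousMap.continuousMapEquiv a)

theorem IsMeasureOn.ae_mem {n : ℕ} {A : Set (EuclideanSpace ℝ (Fin n))}
    {μ : Measure (EuclideanSpace ℝ (Fin n))} (h : IsMeasureOn A μ) : ∀ᵐ x ∂μ, x ∈ A :=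
  h.supported

theorem IsMeasureOn.restrict_eq {n : ℕ} {A : Set (EuclideanSpace ℝ (Fin n))}
    {μ : Measure (EuclideanSpace ℝ (Fin n))} (h : IsMeasureOn A μ) : μ.restrict A = μ :=
  Measure.restrict_eq_self_of_ae_mem h.ae_mem

theorem IsMeasureOn.integrable {n : ℕ} {A : Set (EuclideanSpace ℝ (Fin n))}
    {μ : Measure (EuclideanSpace ℝ (Fin n))} (h : IsMeasureOn A μ) (hA : IsCompact A)
    {w : EuclideanSpace ℝ (Fin n) → ℝ} (hw : ContinuousOn w A) : Integrable w μ := by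
  have := h.finite
  rw [← h.restrict_eq]
  exact hw.integrableOn_compact hA

theorem IsMeasureOn.measureReal_univ {n : ℕ} {A : Set (EuclideanSpace ℝ (Fin n))}
    {μ : Measure (EuclideanSpace ℝ (Fin n))} (h : IsMeasureOn A μ) :
    μ.real univ = μ.real A := by
  rw [← measureReal_restrict_apply_univ A, h.restrict_eq]

theorem IsCompact.bdry {n : ℕ} {X : Set (EuclideanSpace ℝ (Fin n))} (hX : IsCompact X) :
    IsCompact (bdry X) :=
  hX.diff isOpen_interior

/-! ### Weak duality -/

section Duality

variable {n : ℕ} {X : Set (EuclideanSpace ℝ (Fin n))}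
  {f : EuclideanSpace ℝ (Fin n) → EuclideanSpace ℝ (Fin n)}

theorem continuous_lieDer (hf : Continuous f) {v : EuclideanSpace ℝ (Fin n) → ℝ}
    (hv : ContDiff ℝ 1 v) : Continuous (lieDer f v) :=
  (hv.continuous_fderiv one_ne_zero).clm_apply hf

theorem lieDer_add {v v' : EuclideanSpace ℝ (Fin n) → ℝ} (hv : ContDiff ℝ 1 v)
    (hv' : ContDiff ℝ 1 v') (x : EuclideanSpace ℝ (Fin n)) :
    lieDer f (fun y => v y + v' y) x = lieDer f v x + lieDer f v' x := by
  simp only [lieDer]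
  rw [fderiv_fun_add (hv.differentiable one_ne_zero x) (hv'.differentiable one_ne_zero x)]
  rfl

theorem lieDer_const_mul {v : EuclideanSpace ℝ (Fin n) → ℝ} (hv : ContDiff ℝ 1 v) (c : ℝ)
    (x : EuclideanSpace ℝ (Fin n)) : lieDer f (fun y => c * v y) x = c * lieDer f v x := by
  simp only [lieDer]
  rw [fderiv_const_mul (hv.differentiable one_ne_zero x)]
  rfl

theorem lieDer_const (c : ℝ) (x : EuclideanSpace ℝ (Fin n)) : lieDer f (fun _ => c) x = 0 := by
  simp [lieDer]

theorem measureReal_le_integral_of_feasible (hX : IsCompact X) (hf : Continuous f) {T : ℝ}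
    (hT : 0 ≤ T) {μ₀ μhat₀ μ μb : Measure (EuclideanSpace ℝ (Fin n))}
    (hP : PrimalFeasible X f T μ₀ μhat₀ μ μb) {u : ℝ} {v w : EuclideanSpace ℝ (Fin n) → ℝ}
    (hD : DualFeasible X f u v w) : μ₀.real X ≤ ∫ x in X, (w x + u * T) := by
  have hvol : volume X ≠ ⊤ := hX.measure_ne_top
  have := hP.mem_initial.finite
  have := hP.mem_occupation.finite
  have hv := hD.v_contDiff.continuous
  have hmass : μ.real X ≤ T * volume.real X := by
    have h := ENNReal.toReal_mono (ENNReal.mul_ne_top ENNReal.ofReal_ne_top hvol) hP.mass_le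
    rwa [ENNReal.toReal_mul, ENNReal.toReal_ofReal hT] at h
  have hliou := hP.liouville v hD.v_contDiff
  have hlie : ∫ x, lieDer f v x ∂μ ≤ u * μ.real X := by
    have h := integral_mono_ae (hP.mem_occupation.integrable hX
      (continuous_lieDer hf hD.v_contDiff).continuousOn) (integrable_const u)
      (hP.mem_occupation.ae_mem.mono hD.lieDer_le)
    rwa [integral_const, hP.mem_occupation.measureReal_univ, smul_eq_mul, mul_comm] at h
  have hbdry : 0 ≤ ∫ x, v x ∂μb :=
    integral_nonneg_of_ae (hP.mem_boundary.ae_mem.mono hD.v_nonneg)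
  have hw₀ : ∫ x, v x ∂μ₀ + μ₀.real X ≤ ∫ x, w x ∂μ₀ := by
    have h := integral_mono_ae ((hP.mem_initial.integrable hX hv.continuousOn).add
      (integrable_const 1)) (hP.mem_initial.integrable hX hD.w_continuousOn)
      (hP.mem_initial.ae_mem.mono hD.w_ge)
    simp only [Pi.add_apply] at h
    rwa [integral_add (hP.mem_initial.integrable hX hv.continuousOn) (integrable_const 1),
      integral_const, hP.mem_initial.measureReal_univ, smul_eq_mul, mul_one] at h
  have hwhat : 0 ≤ ∫ x, w x ∂μhat₀ :=
    integral_nonneg_of_ae (hP.mem_slack.ae_mem.mono hD.w_nonneg)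
  have hsplit : ∫ x in X, w x = ∫ x, w x ∂μ₀ + ∫ x, w x ∂μhat₀ := by
    rw [← hP.domination, integral_add_measure (hP.mem_initial.integrable hX hD.w_continuousOn)
      (hP.mem_slack.integrable hX hD.w_continuousOn)]
  rw [integral_add (hD.w_continuousOn.integrableOn_compact hX)
    (integrableOn_const hvol), setIntegral_const, smul_eq_mul, hsplit]
  have hu := mul_le_mul_of_nonneg_left hmass hD.u_nonneg
  simp only [divPairing] at hliou
  linarith

theorem primalValue_le_dualValue (hX : IsCompact X) (hf : Continuous f) {T : ℝ} (hT : 0 ≤ T) :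
    primalValue X f T ≤ dualValue X f T := by
  refine sSup_le ?_
  rintro _ ⟨μ₀, μhat₀, μ, μb, hP, rfl⟩
  refine le_sInf ?_
  rintro _ ⟨u, v, w, hD, rfl⟩
  have := hP.mem_initial.finite
  rw [← EReal.coe_ennreal_toReal (measure_ne_top μ₀ X)]
  exact EReal.coe_le_coe_iff.2 (measureReal_le_integral_of_feasible hX hf hT hP hD)

/-! ### The cone of perturbed dual problems -/

/-- Lebesgue measure on `X`, as a measure on the subtype. -/
noncomputable abbrev volumeOn (X : Set (EuclideanSpace ℝ (Fin n))) : Measure X :=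
  volume.comap Subtype.val

theorem volumeOn_univ (hX : IsCompact X) : volumeOn X univ = volume X := by
  rw [volumeOn, comap_subtype_coe_apply hX.measurableSet]
  simp

/-- The constraints and the cost of the dual problem with perturbed right-hand sides: the pairs
`((a, b, c, e), r)` such that some `u ≥ 0`, `v ∈ C¹` and `w ∈ C(X)` satisfy
`a ≤ u - ∇v · f`, `b ≤ w - v`, `c ≤ w` on `X` and `e ≤ v` on `∂X`, and have cost
`∫_X w dλ + u T λ(X) = r`. The dual problem itself has right-hand side `(0, 1, 0, 0)`. -/
def dualCone (X : Set (EuclideanSpace ℝ (Fin n))) [CompactSpace X]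
    [IsFiniteMeasure (volumeOn X)]
    (f : EuclideanSpace ℝ (Fin n) → EuclideanSpace ℝ (Fin n)) (T : ℝ) :
    ConvexCone ℝ ((C(X, ℝ) × C(X, ℝ) × C(X, ℝ) × C(bdry X, ℝ)) × ℝ) where
  carrier := {p | ∃ (u : ℝ) (v : EuclideanSpace ℝ (Fin n) → ℝ) (w : C(X, ℝ)),
    0 ≤ u ∧ ContDiff ℝ 1 v ∧ (∀ x : X, p.1.1 x ≤ u - lieDer f v x) ∧
    (∀ x : X, p.1.2.1 x ≤ w x - v x) ∧ (∀ x : X, p.1.2.2.1 x ≤ w x) ∧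
    (∀ x : bdry X, p.1.2.2.2 x ≤ v x) ∧ p.2 = (∫ x, w x ∂volumeOn X) + u * T * volume.real X}
  smul_mem' := by
    rintro t ht p ⟨u, v, w, hu, hv, ha, hb, hc, he, hr⟩
    refine ⟨t * u, fun y => t * v y, t • w, by positivity, contDiff_const.mul hv, fun x => ?_,
      fun x => ?_, fun x => ?_, fun x => ?_, ?_⟩
    · have := mul_le_mul_of_nonneg_left (ha x) ht.le
      rw [lieDer_const_mul hv]
      simpa [mul_sub] using this
    · have := mul_le_mul_of_nonneg_left (hb x) ht.le
      simpa [mul_sub] using this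
    · have := mul_le_mul_of_nonneg_left (hc x) ht.le
      simpa using this
    · have := mul_le_mul_of_nonneg_left (he x) ht.le
      simpa using this
    · simp only [Prod.smul_snd, hr, ContinuousMap.coe_smul, Pi.smul_apply, smul_eq_mul,
        integral_const_mul]
      ring
  add_mem' := by
    rintro p ⟨u, v, w, hu, hv, ha, hb, hc, he, hr⟩ p'
      ⟨u', v', w', hu', hv', ha', hb', hc', he', hr'⟩
    refine ⟨u + u', fun y => v y + v' y, w + w', by positivity, hv.add hv', fun x => ?_,
      fun x => ?_, fun x => ?_, fun x => ?_, ?_⟩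
    · have := add_le_add (ha x) (ha' x)
      rw [lieDer_add hv hv']
      simp only [Prod.fst_add, ContinuousMap.add_apply]
      linarith
    · have := add_le_add (hb x) (hb' x)
      simp only [Prod.fst_add, Prod.snd_add, ContinuousMap.add_apply]
      linarith
    · exact add_le_add (hc x) (hc' x)
    · exact add_le_add (he x) (he' x)
    · have hw : Integrable w (volumeOn X) :=
        w.continuous.integrable_of_hasCompactSupport (.of_compactSpace _)
      have hw' : Integrable w' (volumeOn X) :=
        w'.continuous.integrable_of_hasCompactSupport (.of_compactSpace _)
      simp only [Prod.snd_add, hr, hr', ContinuousMap.coe_add, Pi.add_apply]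
      rw [integral_add hw hw']
      ring

theorem dualCone_nonempty [CompactSpace X] [CompactSpace (bdry X)]
    [IsFiniteMeasure (volumeOn X)] (T : ℝ)
    (z : C(X, ℝ) × C(X, ℝ) × C(X, ℝ) × C(bdry X, ℝ)) :
    {r : ℝ | (z, r) ∈ dualCone X f T}.Nonempty := by
  obtain ⟨a, b, c, e⟩ := z
  have le_norm : ∀ {K : Type _} [TopologicalSpace K] [CompactSpace K] (h : C(K, ℝ)) (x : K),
      h x ≤ ‖h‖ := fun h x => (le_abs_self _).trans (h.norm_coe_le_norm x)
  refine ⟨_, ‖a‖, fun _ => ‖e‖, .const X (‖b‖ + ‖c‖ + ‖e‖), norm_nonneg a, contDiff_const,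
    fun x => ?_, fun x => ?_, fun x => ?_, fun x => le_norm e x, rfl⟩
  · rw [lieDer_const, sub_zero]
    exact le_norm a x
  · have := le_norm b x
    have := norm_nonneg c
    simp only [ContinuousMap.const_apply]
    linarith
  · have := le_norm c x
    have := norm_nonneg b
    have := norm_nonneg e
    simp only [ContinuousMap.const_apply]
    linarith

theorem dualCone_bddBelow [CompactSpace X] [IsFiniteMeasure (volumeOn X)] {T : ℝ}
    (hT : 0 ≤ T) (z : C(X, ℝ) × C(X, ℝ) × C(X, ℝ) × C(bdry X, ℝ)) :
    BddBelow {r : ℝ | (z, r) ∈ dualCone X f T} := by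
  refine ⟨∫ x, z.2.2.1 x ∂volumeOn X, ?_⟩
  rintro _ ⟨u, v, w, hu, -, -, -, hc, -, rfl⟩
  have h := integral_mono (μ := (volumeOn X))
    (z.2.2.1.continuous.integrable_of_hasCompactSupport (.of_compactSpace _))
    (w.continuous.integrable_of_hasCompactSupport (.of_compactSpace _)) hc
  have : 0 ≤ u * T * volume.real X := by positivity
  exact h.trans (le_add_of_nonneg_right this)

/-- An attainable cost for the right-hand side `(0, 1, 0, 0)` is the cost of a feasible triplet of
the dual problem. -/
theorem dualValue_le_of_mem_dualCone (hX : IsCompact X) [CompactSpace X]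
    [IsFiniteMeasure (volumeOn X)] {T r : ℝ} (hr : ((0, 1, 0, 0), r) ∈ dualCone X f T) :
    dualValue X f T ≤ r := by
  obtain ⟨u, v, w, hu, hv, ha, hb, hc, he, rfl⟩ := hr
  -- `w` lives on `X` only; its extension to `ℝⁿ` by zero is continuous on `X`.
  have hw : ∀ x : X, Function.extend Subtype.val w 0 (x : EuclideanSpace ℝ (Fin n)) = w x :=
    fun x => Subtype.val_injective.extend_apply _ _ _
  refine sInf_le ⟨u, v, Function.extend Subtype.val w 0, ⟨hu, hv, ?_, fun x hx => ?_,
    fun x hx => ?_, fun x hx => ?_, fun x hx => he ⟨x, hx⟩⟩, ?_⟩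
  · rw [continuousOn_iff_continuous_domRestrict]
    exact w.continuous.congr fun x => (hw x).symm
  · exact sub_nonneg.1 (ha ⟨x, hx⟩)
  · rw [hw ⟨x, hx⟩]
    exact le_sub_iff_add_le'.1 (hb ⟨x, hx⟩)
  · rw [hw ⟨x, hx⟩]
    exact hc ⟨x, hx⟩
  · rw [← integral_subtype_comap hX.measurableSet]
    simp_rw [hw]
    rw [integral_add (w.continuous.integrable_of_hasCompactSupport (.of_compactSpace _))
      (integrable_const _), integral_const, smul_eq_mul]
    have : (volumeOn X).real univ = volume.real X := by
      rw [measureReal_def, volumeOn_univ hX, measureReal_def]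
    rw [this, mul_comm (volume.real X)]

/-! ### Strong duality -/

/-- Strong duality, with an optimal primal solution: the measures representing a linear minorant
of the perturbed dual value are feasible for the primal problem. -/
theorem exists_primalFeasible_dualValue_le (hne : X.Nonempty) (hX : IsCompact X)
    (hf : Continuous f) {T : ℝ} (hT : 0 ≤ T) :
    ∃ μ₀ μhat₀ μ μb : Measure (EuclideanSpace ℝ (Fin n)),
      PrimalFeasible X f T μ₀ μhat₀ μ μb ∧ dualValue X f T ≤ ((μ₀ X : ENNReal) : EReal) := by
  have hvol : volume X ≠ ⊤ := hX.measure_ne_top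
  have : CompactSpace X := isCompact_iff_compactSpace.1 hX
  have : CompactSpace (bdry X) := isCompact_iff_compactSpace.1 hX.bdry
  have : Nonempty X := hne.to_subtype
  have : IsFiniteMeasure (volumeOn X) := ⟨by
    rw [volumeOn_univ hX]
    exact hvol.lt_top⟩
  have hz₀ : ((0, 1, 0, 0) : C(X, ℝ) × C(X, ℝ) × C(X, ℝ) × C(bdry X, ℝ)) ≠ 0 := by
    intro h
    exact one_ne_zero (congrArg (fun z => z.2.1) h)
  obtain ⟨L, hL, hLz₀⟩ := exists_linearMap_le_of_cone (dualCone X f T) (dualCone_nonempty T)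
    (dualCone_bddBelow hT) hz₀
  have hLneg : ∀ z, (∀ x, 0 ≤ z.1 x) → (∀ x, 0 ≤ z.2.1 x) → (∀ x, 0 ≤ z.2.2.1 x) →
      (∀ x, 0 ≤ z.2.2.2 x) → 0 ≤ L z := by
    intro z ha hb hc he
    have h : L (-z) ≤ 0 := hL _ _ ⟨0, fun _ => 0, 0, le_rfl, contDiff_const,
      fun x => by simpa [lieDer_const] using ha x, fun x => by simpa using hb x,
      fun x => by simpa using hc x, fun x => by simpa using he x, by simp⟩
    rw [map_neg] at h
    linarith
  have hzero : ∀ {K : Type _} [TopologicalSpace K] (x : K), 0 ≤ (0 : C(K, ℝ)) x :=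
    fun _ => le_rfl
  obtain ⟨μ, hμ, hμi⟩ := exists_isMeasureOn_of_nonneg hX (L ∘ₗ LinearMap.inl ℝ _ _)
    fun a ha => hLneg _ (fun x => ha x) hzero hzero hzero
  obtain ⟨μ₀, hμ₀, hμ₀i⟩ := exists_isMeasureOn_of_nonneg hX
    (L ∘ₗ LinearMap.inr ℝ _ _ ∘ₗ LinearMap.inl ℝ _ _)
    fun a ha => hLneg _ hzero (fun x => ha x) hzero hzero
  obtain ⟨μhat₀, hμhat₀, hμhat₀i⟩ := exists_isMeasureOn_of_nonneg hX
    (L ∘ₗ LinearMap.inr ℝ _ _ ∘ₗ LinearMap.inr ℝ _ _ ∘ₗ LinearMap.inl ℝ _ _)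
    fun a ha => hLneg _ hzero hzero (fun x => ha x) hzero
  obtain ⟨μb, hμb, hμbi⟩ := exists_isMeasureOn_of_nonneg hX.bdry
    (L ∘ₗ LinearMap.inr ℝ _ _ ∘ₗ LinearMap.inr ℝ _ _ ∘ₗ LinearMap.inr ℝ _ _)
    fun a ha => hLneg _ hzero hzero hzero (fun x => ha x)
  have := hμ.finite
  have := hμ₀.finite
  have := hμhat₀.finite
  -- The functional evaluated at the perturbation for which `(u, v, w)` is tight.
  have key : ∀ (u : ℝ) (v w : EuclideanSpace ℝ (Fin n) → ℝ), 0 ≤ u → ContDiff ℝ 1 v →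
      Continuous w → u * μ.real X - ∫ x, lieDer f v x ∂μ + (∫ x, w x ∂μ₀ - ∫ x, v x ∂μ₀) +
        ∫ x, w x ∂μhat₀ + ∫ x, v x ∂μb ≤ (∫ x in X, w x) + u * T * volume.real X := by
    intro u v w hu hv hw
    have hlie := continuous_lieDer hf hv
    let a : C(X, ℝ) := ⟨fun x => u - lieDer f v x, by fun_prop⟩
    let b : C(X, ℝ) := ⟨fun x => w x - v x, by have := hv.continuous; fun_prop⟩
    let c : C(X, ℝ) := ⟨fun x => w x, by fun_prop⟩
    let e : C(bdry X, ℝ) := ⟨fun x => v x, by have := hv.continuous; fun_prop⟩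
    have h : L (a, b, c, e) ≤ (∫ x, w x ∂volumeOn X) + u * T * volume.real X :=
      hL _ _ ⟨u, v, c, hu, hv, fun _ => le_rfl, fun _ => le_rfl, fun _ => le_rfl, fun _ => le_rfl,
        rfl⟩
    have hsum : L (a, b, c, e) = L (a, 0, 0, 0) + L (0, b, 0, 0) + L (0, 0, c, 0) +
        L (0, 0, 0, e) := by
      simp only [← map_add, Prod.mk_add_mk, add_zero, zero_add]
    have ha : ∫ x, (u - lieDer f v x) ∂μ = L (a, 0, 0, 0) := hμi _ a fun _ => rfl
    have hb : ∫ x, (w x - v x) ∂μ₀ = L (0, b, 0, 0) := hμ₀i _ b fun _ => rfl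
    have hc : ∫ x, w x ∂μhat₀ = L (0, 0, c, 0) := hμhat₀i _ c fun _ => rfl
    have he : ∫ x, v x ∂μb = L (0, 0, 0, e) := hμbi _ e fun _ => rfl
    rw [integral_sub (integrable_const u) (hμ.integrable hX hlie.continuousOn), integral_const,
      hμ.measureReal_univ, smul_eq_mul, mul_comm] at ha
    rw [integral_sub (hμ₀.integrable hX hw.continuousOn)
      (hμ₀.integrable hX hv.continuous.continuousOn)] at hb
    rw [integral_subtype_comap hX.measurableSet, hsum, ← ha, ← hb, ← hc, ← he] at h
    exact h
  refine ⟨μ₀, μhat₀, μ, μb, ⟨hμ₀, hμhat₀, hμ, hμb, fun v hv => ?_, ?_, ?_⟩, ?_⟩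
  · have h₁ := key 0 v 0 le_rfl hv continuous_zero
    have h₂ := key 0 (fun y => (-1) * v y) 0 le_rfl (contDiff_const.mul hv) continuous_zero
    simp only [lieDer_const_mul hv, integral_const_mul, Pi.zero_apply, integral_zero] at h₁ h₂
    simp only [divPairing]
    linarith
  · have : IsFiniteMeasure (volume.restrict X) := isFiniteMeasure_restrict.2 hvol
    refine ext_of_forall_integral_eq_of_IsFiniteMeasure fun w => ?_
    have h₁ := key 0 (fun _ => 0) w le_rfl contDiff_const w.continuous
    have h₂ := key 0 (fun _ => 0) (-w) le_rfl contDiff_const w.continuous.neg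
    simp only [lieDer_const, integral_zero, Pi.neg_apply, integral_neg] at h₁ h₂
    rw [integral_add_measure (w.integrable _) (w.integrable _)]
    linarith
  · have h := key 1 (fun _ => 0) 0 zero_le_one contDiff_const continuous_zero
    simp only [lieDer_const, integral_zero, Pi.zero_apply] at h
    rw [← ENNReal.ofReal_toReal hvol, ← ENNReal.ofReal_mul hT,
      ← ENNReal.ofReal_toReal (measure_ne_top μ X)]
    refine ENNReal.ofReal_le_ofReal ?_
    simp only [measureReal_def] at h
    linarith
  · have hmass : μ₀.real X = sInf {r : ℝ | ((0, 1, 0, 0), r) ∈ dualCone X f T} := by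
      rw [← hLz₀]
      have h : ∫ _, (1 : ℝ) ∂μ₀ = L (0, 1, 0, 0) := hμ₀i (fun _ => 1) 1 fun _ => rfl
      rwa [integral_const, hμ₀.measureReal_univ, smul_eq_mul, mul_one] at h
    rw [← EReal.coe_ennreal_toReal (measure_ne_top μ₀ X)]
    refine EReal.le_of_forall_lt_iff_le.1 fun s hs => ?_
    have hs' : sInf {r : ℝ | ((0, 1, 0, 0), r) ∈ dualCone X f T} < s := by
      rw [← hmass]
      exact EReal.coe_lt_coe_iff.1 hs
    obtain ⟨r, hr, hrs⟩ := exists_lt_of_csInf_lt (dualCone_nonempty T _) hs'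
    exact (dualValue_le_of_mem_dualCone hX hr).trans (EReal.coe_le_coe_iff.2 hrs.le)

end Duality

theorem continuous_polyField {n : ℕ} (F : Fin n → MvPolynomial (Fin n) ℝ) :
    Continuous (polyField F) := by
  refine (PiLp.continuous_toLp 2 _).comp (continuous_pi fun i => ?_)
  exact (MvPolynomial.continuous_eval (F i)).comp (PiLp.continuous_ofLp 2 _)

theorem theorem4 {n m : ℕ} (F : Fin n → MvPolynomial (Fin n) ℝ)
    (g : Fin m → MvPolynomial (Fin n) ℝ)
    (hne : (semialgSet g).Nonempty) (hcpt : IsCompact (semialgSet g))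
    (T : ℝ) (hT : 0 ≤ T) :
    primalValue (semialgSet g) (polyField F) T = dualValue (semialgSet g) (polyField F) T := by
  refine le_antisymm (primalValue_le_dualValue hcpt (continuous_polyField F) hT) ?_
  obtain ⟨μ₀, μhat₀, μ, μb, hP, hle⟩ :=
    exists_primalFeasible_dualValue_le hne hcpt (continuous_polyField F) hT
  exact hle.trans (le_sSup ⟨μ₀, μhat₀, μ, μb, hP, rfl⟩)
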